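/- Let $(M,\mu)$ be a finite measure space and let $\mathcal E$ be a Dirichlet form on $L^2(M,\mu)$, that is, a nonnegative, symmetric, closed bilinear form defined on a dense subspace $\mathcal D(\mathcal E)\subset L^2(M,\mu)$ such that, writing $\mathcal E(v)=\mathcal E(v,v)$, (i) $v\in\mathcal D(\mathcal E)$ implies $|v|\in\mathcal D(\mathcal E)$ and $\mathcal E(|v|)\le\mathcal E(v)$; (ii) $v\in\mathcal D(\mathcal E)$ and $v\ge 0$ imply $\inf\{v,1\}\in\mathcal D(\mathcal E)$ and $\mathcal E(\inf\{v,1\})\le\mathcal E(v)$. Suppose that, for some $\nu>2$ and $A,B>0$, the Sobolev inequality $$\|v\|_{L^{2\nu/(\nu-2)}}^2\le A\,\mathcal E(v)+B\,\|v\|_{L^2}^2\qquad\text{for all } v\in\mathcal D(\mathcal E)$$ holds. Let $W\ge 0$ be a measurable function with $W\in L^q(M,\mu)$ for some $q\in(\nu/2,\infty]$, and let $u\in\mathcal D(\mathcal E)$ be a nonnegative function satisfying $Lu\le Wu$, where $L$ is the generator of $\mathcal E$, in the weak sense that $$\mathcal E(u,\varphi)\le\int_M W u\varphi\,d\mu\qquad\text{for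 all } \varphi\in\mathcal D(\mathcal E) \text{ with } \varphi\ge 0 .$$ Then $u\in L^\infty(M,\mu)$ and $$\|u\|_{L^\infty}\le C\,\|u\|_{L^2}.$$ Here the constant $C$ depends only on $\nu$, $q$, $A$, $B$ and an upper bound $K$ for $\|W\|_{L^q}$ (one may take $K=\|W\|_{L^q}$); in particular it does not depend on $(M,\mu)$, $\mathcal E$, $W$ or $u$ otherwise. -/

import Mathlib

open MeasureTheory Filter Topology
open scoped ENNReal NNReal

universe u

/-- A closed symmetric form on `L²(M, μ)`: a nonnegative symmetric bilinear form defined on a dense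
linear subspace of `L²(M, μ)` which is closed, that is, its domain is complete for the norm
`(𝓔(v, v) + ‖v‖²) ^ (1/2)`. -/
structure ClosedSymmetricForm {M : Type u} [MeasurableSpace M] (μ : Measure M) where
  /-- The domain `𝓓(𝓔)`. -/
  domain : Submodule ℝ (Lp ℝ 2 μ)
  dense_domain : Dense (domain : Set (Lp ℝ 2 μ))
  /-- The bilinear form `𝓔`. -/
  form : domain →ₗ[ℝ] domain →ₗ[ℝ] ℝ
  symm : ∀ v w : domain, form v w = form w v
  nonneg : ∀ v : domain, 0 ≤ form v v
  /-- If `vₙ → w` in `L²` and `(vₙ)` is Cauchy for `𝓔`, then `w` lies in the domain and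
  `vₙ → w` for `𝓔`. -/
  closed : ∀ (v : ℕ → domain) (w : Lp ℝ 2 μ),
    Tendsto (fun n => (v n : Lp ℝ 2 μ)) atTop (𝓝 w) →
    Tendsto (fun p : ℕ × ℕ => form (v p.1 - v p.2) (v p.1 - v p.2)) atTop (𝓝 0) →
    ∃ hw : w ∈ domain,
      Tendsto (fun n => form (v n - ⟨w, hw⟩) (v n - ⟨w, hw⟩)) atTop (𝓝 0)

/-- A Dirichlet form on `L²(M, μ)`, with `μ` finite: a closed symmetric form on which the
contractions `v ↦ |v|` and, for `v ≥ 0`, `v ↦ inf {v, 1}` operate. Absolute value, order and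
infimum are those of the lattice `L²(M, μ)`, i.e. almost everywhere pointwise. -/
structure DirichletForm {M : Type u} [MeasurableSpace M] (μ : Measure M) [IsFiniteMeasure μ]
    extends ClosedSymmetricForm μ where
  abs_contraction : ∀ v : domain, ∃ h : |(v : Lp ℝ 2 μ)| ∈ domain,
    form ⟨|(v : Lp ℝ 2 μ)|, h⟩ ⟨|(v : Lp ℝ 2 μ)|, h⟩ ≤ form v v
  inf_one_contraction : ∀ v : domain, 0 ≤ (v : Lp ℝ 2 μ) →
    ∃ h : (v : Lp ℝ 2 μ) ⊓ Lp.const 2 μ (1 : ℝ) ∈ domain,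
      form ⟨(v : Lp ℝ 2 μ) ⊓ Lp.const 2 μ (1 : ℝ), h⟩
        ⟨(v : Lp ℝ 2 μ) ⊓ Lp.const 2 μ (1 : ℝ), h⟩ ≤ form v v

namespace DirichletForm

variable {M : Type u} [MeasurableSpace M] {μ : Measure M} [IsFiniteMeasure μ]

/-- The Sobolev inequality `‖v‖²_{L^{2ν/(ν-2)}} ≤ A 𝓔(v, v) + B ‖v‖²_{L²}` for all `v ∈ 𝓓(𝓔)`.
The left side is an extended real number, so that `v ∈ L^{2ν/(ν-2)}` is part of the assertion. -/
def SobolevInequality (E : DirichletForm μ) (ν A B : ℝ) : Prop :=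
  ∀ v : E.domain,
    eLpNorm (v : Lp ℝ 2 μ) (ENNReal.ofReal (2 * ν / (ν - 2))) μ ^ 2 ≤
      ENNReal.ofReal (A * E.form v v + B * ‖(v : Lp ℝ 2 μ)‖ ^ 2)

/-- For a nonnegative `u ∈ 𝓓(𝓔)` and a nonnegative function `W`, the inequality `L u ≤ W u` in
the weak sense: `𝓔(u, φ) ≤ ∫ W u φ dμ` for all nonnegative `φ ∈ 𝓓(𝓔)`. The integral of the
nonnegative function `W u φ` is taken in `[0, ∞]`. -/
def IsSubsolution (E : DirichletForm μ) (W : M → ℝ) (u : E.domain) : Prop :=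
  ∀ φ : E.domain, 0 ≤ (φ : Lp ℝ 2 μ) →
    ENNReal.ofReal (E.form u φ) ≤
      ∫⁻ x, ENNReal.ofReal (W x * (u : Lp ℝ 2 μ) x * (φ : Lp ℝ 2 μ) x) ∂μ

end DirichletForm

/-! De Giorgi–Stampacchia iteration on superlevel sets. With `w = (u - k)₊`, the contraction
property gives `𝓔(w) ≤ 𝓔(u, w)` (`DirichletForm.exists_posPart_sub_const`), so testing the
subsolution inequality with `w` bounds `𝓔(w)` by `∫ W u w`. On `{u > k}` one has `u = w + k`, and
Hölder gains a positive power of `μ {u > k}`, because `1/q + 2/p < 1` for the Sobolev exponent `p`.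
If `μ {u > k}` is small, the terms quadratic in `w` are absorbed by the Sobolev inequality
(`le_of_sq_le_energy`).

What remains bounds `‖w‖_p` linearly in `k`, and Chebyshev turns it into `(h - k) y(h) ≤ 2 A K k
y(k)^(1+α)` for `y(k) = μ {u > k}^(1/p)`. Along levels increasing from `k` to `2k` this superlinear
recursion forces `y → 0` (`le_mul_pow_of_superlinear_recursion`), so `u ≤ 2k` almost everywhere. The
smallness needed at the start follows from Chebyshev in `L²` once `k` is a suitable multiple of
`‖u‖₂`. The multiple depends only on `p`, `q`, `A`, `B`, `K`. -/

/-! ### Truncations in a Dirichlet form -/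

/-- The truncation `v ⊓ k`, for a level `k > 0`, operates on a Dirichlet form. -/
theorem DirichletForm.inf_const_contraction {M : Type u} [MeasurableSpace M] {μ : Measure M}
    [IsFiniteMeasure μ] (E : DirichletForm μ) {k : ℝ} (hk : 0 < k) (v : E.domain)
    (hv : 0 ≤ (v : Lp ℝ 2 μ)) :
    ∃ h : (v : Lp ℝ 2 μ) ⊓ Lp.const 2 μ k ∈ E.domain,
      E.form ⟨(v : Lp ℝ 2 μ) ⊓ Lp.const 2 μ k, h⟩ ⟨(v : Lp ℝ 2 μ) ⊓ Lp.const 2 μ k, h⟩ ≤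
        E.form v v := by
  have hv' : 0 ≤ ((k⁻¹ • v : E.domain) : Lp ℝ 2 μ) := by
    rw [← Lp.coeFn_nonneg] at hv ⊢
    filter_upwards [hv, Lp.coeFn_smul k⁻¹ (v : Lp ℝ 2 μ)] with x hx hs
    rw [Submodule.coe_smul, hs]
    exact mul_nonneg (inv_nonneg.2 hk.le) hx
  obtain ⟨h, hle⟩ := E.inf_one_contraction (k⁻¹ • v) hv'
  have key : (v : Lp ℝ 2 μ) ⊓ Lp.const 2 μ k =
      k • (((k⁻¹ • v : E.domain) : Lp ℝ 2 μ) ⊓ Lp.const 2 μ (1 : ℝ)) := by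
    apply Lp.ext
    filter_upwards [Lp.coeFn_inf (v : Lp ℝ 2 μ) (Lp.const 2 μ k),
      Lp.coeFn_inf ((k⁻¹ • v : E.domain) : Lp ℝ 2 μ) (Lp.const 2 μ (1 : ℝ)),
      Lp.coeFn_const (p := 2) (μ := μ) k, Lp.coeFn_const (p := 2) (μ := μ) (1 : ℝ),
      Lp.coeFn_smul k⁻¹ (v : Lp ℝ 2 μ),
      Lp.coeFn_smul k (((k⁻¹ • v : E.domain) : Lp ℝ 2 μ) ⊓ Lp.const 2 μ (1 : ℝ))]
      with x h1 h2 h3 h4 h5 h6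
    rw [h1, h6, Pi.smul_apply, h2, Pi.inf_apply, Pi.inf_apply, h3, h4, Submodule.coe_smul, h5]
    simp only [Pi.smul_apply, smul_eq_mul, Function.const_apply]
    rw [mul_min_of_nonneg _ _ hk.le, mul_inv_cancel_left₀ hk.ne', mul_one]
  have hmem : (v : Lp ℝ 2 μ) ⊓ Lp.const 2 μ k ∈ E.domain := by
    rw [key]; exact E.domain.smul_mem _ h
  refine ⟨hmem, ?_⟩
  have hsub : (⟨(v : Lp ℝ 2 μ) ⊓ Lp.const 2 μ k, hmem⟩ : E.domain) =
      k • ⟨((k⁻¹ • v : E.domain) : Lp ℝ 2 μ) ⊓ Lp.const 2 μ (1 : ℝ), h⟩ := Subtype.ext key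
  rw [hsub]
  simp only [map_smul, LinearMap.smul_apply, smul_eq_mul] at hle ⊢
  calc _ ≤ k * (k * (k⁻¹ * (k⁻¹ * E.form v v))) := by gcongr
    _ = E.form v v := by field_simp

/-- First-order condition: the difference quotient of a quadratic energy along a ray, as `t → 0`. -/
theorem nonneg_of_forall_add_mul_nonneg {a b : ℝ}
    (h : ∀ t : ℝ, 0 < t → t ≤ 1 → 0 ≤ 2 * a + t * b) : 0 ≤ a := by
  have hlim : Tendsto (fun t : ℝ => 2 * a + t * b) (𝓝[>] 0) (𝓝 (2 * a + 0 * b)) :=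
    ((continuous_const.add (continuous_id.mul continuous_const)).tendsto 0).mono_left
      nhdsWithin_le_nhds
  have h0 := ge_of_tendsto hlim (by
    filter_upwards [Ioc_mem_nhdsGT (zero_lt_one' ℝ)] with t ht using h t ht.1 ht.2)
  linarith

/-- The part `(v - k)₊` of `v ≥ 0` above a level `k > 0` lies in the domain, and its energy is at
most `𝓔(v, (v - k)₊)`. -/
theorem DirichletForm.exists_posPart_sub_const {M : Type u} [MeasurableSpace M] {μ : Measure M}
    [IsFiniteMeasure μ] (E : DirichletForm μ) {k : ℝ} (hk : 0 < k) (v : E.domain)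
    (hv : 0 ≤ (v : Lp ℝ 2 μ)) :
    ∃ z : E.domain, (z : Lp ℝ 2 μ) =ᵐ[μ] (fun x => max ((v : Lp ℝ 2 μ) x - k) 0) ∧
      0 ≤ (z : Lp ℝ 2 μ) ∧ E.form z z ≤ E.form v z := by
  obtain ⟨h, -⟩ := E.inf_const_contraction hk v hv
  set w : E.domain := ⟨(v : Lp ℝ 2 μ) ⊓ Lp.const 2 μ k, h⟩ with hw
  have hwx : (w : Lp ℝ 2 μ) =ᵐ[μ] fun x => min ((v : Lp ℝ 2 μ) x) k := by
    filter_upwards [Lp.coeFn_inf (v : Lp ℝ 2 μ) (Lp.const 2 μ k),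
      Lp.coeFn_const (p := 2) (μ := μ) k] with x h1 h2
    rw [hw, h1, Pi.inf_apply, h2]; rfl
  have hzx : ((v - w : E.domain) : Lp ℝ 2 μ) =ᵐ[μ]
      fun x => max ((v : Lp ℝ 2 μ) x - k) 0 := by
    filter_upwards [hwx, Lp.coeFn_sub (v : Lp ℝ 2 μ) (w : Lp ℝ 2 μ)] with x h1 h2
    rw [Submodule.coe_sub, h2, Pi.sub_apply, h1]
    rcases le_total ((v : Lp ℝ 2 μ) x) k with h | h <;> simp [h]
  refine ⟨v - w, hzx, ?_, ?_⟩
  · rw [← Lp.coeFn_nonneg]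
    filter_upwards [hzx] with x hx
    rw [hx]; exact le_max_right _ _
  -- With `w = v ⊓ k`, moving from `w` towards `v` changes values only where `v > k`, and there
  -- upwards; truncating `w + t (v - w)` at `k` thus gives back `w`. Hence `𝓔(w) ≤ 𝓔(w + t (v -
  -- w))`, whose first-order term yields `𝓔(w, v - w) ≥ 0`.
  have hpos : 0 ≤ E.form w (v - w) := by
    refine nonneg_of_forall_add_mul_nonneg (b := E.form (v - w) (v - w)) fun t ht ht1 => ?_
    have hsx : ((w + t • (v - w) : E.domain) : Lp ℝ 2 μ) =ᵐ[μ] fun x =>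
        min ((v : Lp ℝ 2 μ) x) k + t * max ((v : Lp ℝ 2 μ) x - k) 0 := by
      filter_upwards [hwx, hzx, Lp.coeFn_add (w : Lp ℝ 2 μ) (t • (v - w : E.domain) : E.domain),
        Lp.coeFn_smul t ((v - w : E.domain) : Lp ℝ 2 μ)] with x h1 h2 h3 h4
      rw [Submodule.coe_add, h3, Pi.add_apply, Submodule.coe_smul, h4, Pi.smul_apply, h1, h2,
        smul_eq_mul]
    have hs : 0 ≤ ((w + t • (v - w) : E.domain) : Lp ℝ 2 μ) := by
      rw [← Lp.coeFn_nonneg] at hv ⊢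
      filter_upwards [hsx, hv] with x hx hvx
      rw [hx]
      exact add_nonneg (le_min hvx hk.le) (mul_nonneg ht.le (le_max_right _ _))
    obtain ⟨h', hle⟩ := E.inf_const_contraction hk (w + t • (v - w)) hs
    have heq : (⟨((w + t • (v - w) : E.domain) : Lp ℝ 2 μ) ⊓ Lp.const 2 μ k, h'⟩ : E.domain) = w := by
      apply Subtype.ext
      apply Lp.ext
      filter_upwards [hwx, hsx, Lp.coeFn_inf ((w + t • (v - w) : E.domain) : Lp ℝ 2 μ)
        (Lp.const 2 μ k), Lp.coeFn_const (p := 2) (μ := μ) k] with x h1 h2 h3 h4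
      rw [h3, Pi.inf_apply, h4, h1, h2, Function.const_apply]
      rcases le_total ((v : Lp ℝ 2 μ) x) k with h | h
      · simp [h]
      · have : 0 ≤ t * ((v : Lp ℝ 2 μ) x - k) := mul_nonneg ht.le (sub_nonneg.2 h)
        simp [h, this]
    rw [heq] at hle
    have hexp : E.form (w + t • (v - w)) (w + t • (v - w)) =
        E.form w w + t * (2 * E.form w (v - w) + t * E.form (v - w) (v - w)) := by
      have hsymm := E.symm (v - w) w
      simp only [map_add, map_smul, LinearMap.add_apply, LinearMap.smul_apply, smul_eq_mul]
      rw [hsymm]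
      ring
    rw [hexp] at hle
    exact nonneg_of_mul_nonneg_right (by linarith) ht
  have : E.form v (v - w) = E.form w (v - w) + E.form (v - w) (v - w) := by
    rw [← LinearMap.add_apply, ← map_add, add_sub_cancel]
  linarith

/-! ### Hölder and Chebyshev estimates on superlevel sets -/

/-- Hölder with exponents `q, p, p` lands in an `L^r` with `r ≥ 1`; the passage to `L¹` costs a
power of the total mass. Applied to `μ` restricted to a superlevel set, that power is the gain
driving the iteration. -/
theorem lintegral_enorm_mul_mul_le {M : Type*} [MeasurableSpace M] {μ : Measure M}
    {W f g : M → ℝ} {p q : ℝ≥0∞} (hW : AEStronglyMeasurable W μ)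
    (hf : AEStronglyMeasurable f μ) (hg : AEStronglyMeasurable g μ)
    (hpq : q⁻¹ + (p⁻¹ + p⁻¹) ≤ 1) :
    ∫⁻ x, ‖W x * (f x * g x)‖ₑ ∂μ ≤
      eLpNorm W q μ * (eLpNorm f p μ * eLpNorm g p μ) *
        μ Set.univ ^ (1 - (q⁻¹ + (p⁻¹ + p⁻¹)).toReal) := by
  have hs : ENNReal.HolderTriple p p (p⁻¹ + p⁻¹)⁻¹ := ⟨by rw [inv_inv]⟩
  have hr : ENNReal.HolderTriple q (p⁻¹ + p⁻¹)⁻¹ (q⁻¹ + (p⁻¹ + p⁻¹))⁻¹ :=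
    ⟨by rw [inv_inv, inv_inv]⟩
  have h1 := eLpNorm_le_eLpNorm_mul_rpow_measure_univ (μ := μ) (f := W • (f • g))
    (ENNReal.one_le_inv.2 hpq) (hW.smul (hf.smul hg))
  have h2 := eLpNorm_smul_le_mul_eLpNorm (hf.smul hg) hW
    (r := (q⁻¹ + (p⁻¹ + p⁻¹))⁻¹) (q := (p⁻¹ + p⁻¹)⁻¹) (p := q)
  have h3 := eLpNorm_smul_le_mul_eLpNorm hg hf (r := (p⁻¹ + p⁻¹)⁻¹) (q := p) (p := p)
  rw [eLpNorm_one_eq_lintegral_enorm] at h1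
  refine h1.trans ?_
  rw [ENNReal.toReal_inv, ENNReal.toReal_one, one_div_one, one_div, inv_inv]
  gcongr
  exact h2.trans (by gcongr)

/-- On the superlevel set `{f > k}` the function `f` is the sum of `k` and of `w = (f - k)₊`. -/
theorem lintegral_mul_posPart_sub_le {M : Type*} [MeasurableSpace M] {μ : Measure M}
    [IsFiniteMeasure μ] {W f : M → ℝ} {p q : ℝ≥0∞} {k : ℝ} (hk : 0 ≤ k)
    (hW : AEStronglyMeasurable W μ) (hf : Measurable f) (hp : 1 ≤ p) (hp' : p ≠ ∞)
    (hpq : q⁻¹ + (p⁻¹ + p⁻¹) ≤ 1) :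
    ∫⁻ x, ENNReal.ofReal (W x * f x * max (f x - k) 0) ∂μ ≤
      eLpNorm W q μ * ((eLpNorm (fun x => max (f x - k) 0) p μ +
        ENNReal.ofReal k * μ {x | k < f x} ^ p.toReal⁻¹) *
          eLpNorm (fun x => max (f x - k) 0) p μ) *
        μ {x | k < f x} ^ (1 - (q⁻¹ + (p⁻¹ + p⁻¹)).toReal) := by
  set A := {x | k < f x} with hA
  set w := fun x => max (f x - k) 0 with hw
  have hAm : MeasurableSet A := measurableSet_lt measurable_const hf
  have hwm : Measurable w := (hf.sub_const k).max measurable_const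
  have hp0 : p ≠ 0 := (zero_lt_one.trans_le hp).ne'
  have hsupp : Function.support w ⊆ A := by
    intro x hx
    by_contra hxA
    exact hx (max_eq_right (sub_nonpos.2 (not_lt.1 hxA)))
  have h1 : ∫⁻ x, ENNReal.ofReal (W x * f x * w x) ∂μ ≤
      ∫⁻ x in A, ‖W x * (f x * w x)‖ₑ ∂μ := by
    rw [← lintegral_indicator hAm]
    refine lintegral_mono fun x => ?_
    by_cases hx : x ∈ A
    · rw [Set.indicator_of_mem hx, mul_assoc]
      exact Real.ofReal_le_enorm _
    · have : w x = 0 := by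
        by_contra h
        exact hx (hsupp h)
      simp [this]
  have h2 : eLpNorm f p (μ.restrict A) ≤
      eLpNorm w p μ + ENNReal.ofReal k * μ A ^ p.toReal⁻¹ := by
    have heq : f =ᵐ[μ.restrict A] w + fun _ => k := by
      filter_upwards [ae_restrict_mem hAm] with x hx
      have : k < f x := hx
      simp [hw, this.le]
    rw [eLpNorm_congr_ae heq]
    refine (eLpNorm_add_le hwm.aestronglyMeasurable aestronglyMeasurable_const hp).trans ?_
    rw [eLpNorm_restrict_eq_of_support_subset hsupp, eLpNorm_const' _ hp0 hp',
      Measure.restrict_apply_univ, Real.enorm_eq_ofReal hk, one_div]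
  refine h1.trans ((lintegral_enorm_mul_mul_le (p := p) (q := q) hW.restrict
    hf.aestronglyMeasurable hwm.aestronglyMeasurable hpq).trans ?_)
  rw [Measure.restrict_apply_univ, eLpNorm_restrict_eq_of_support_subset hsupp]
  gcongr
  exact Measure.restrict_le_self

/-- The support lies in `{f > k}`, so Hölder on that set gains a power of its measure. This makes
the `B ‖w‖₂²` term absorbable. -/
theorem eLpNorm_two_posPart_sub_le {M : Type*} [MeasurableSpace M] {μ : Measure M}
    {f : M → ℝ} {p : ℝ≥0∞} (k : ℝ) (hf : Measurable f) (hp : 2 ≤ p) :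
    eLpNorm (fun x => max (f x - k) 0) 2 μ ≤ eLpNorm (fun x => max (f x - k) 0) p μ *
      μ {x | k < f x} ^ (1 / 2 - p.toReal⁻¹) := by
  have hsupp : Function.support (fun x => max (f x - k) 0) ⊆ {x | k < f x} := by
    intro x hx
    by_contra hxA
    exact hx (max_eq_right (sub_nonpos.2 (not_lt.1 hxA)))
  have hwm : Measurable fun x => max (f x - k) 0 := (hf.sub_const k).max measurable_const
  have h := eLpNorm_le_eLpNorm_mul_rpow_measure_univ (μ := μ.restrict {x | k < f x}) hp
    hwm.aestronglyMeasurable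
  rwa [Measure.restrict_apply_univ, eLpNorm_restrict_eq_of_support_subset hsupp,
    eLpNorm_restrict_eq_of_support_subset hsupp, ENNReal.toReal_ofNat, one_div p.toReal] at h

/-- Chebyshev, since `(f - k)₊ ≥ h - k` on `{f > h}`. It serves with the Sobolev exponent in the
recursion, and with `p = 2`, `k = 0` to start it. -/
theorem mul_rpow_measure_lt_le_eLpNorm {M : Type*} [MeasurableSpace M] {μ : Measure M}
    {f : M → ℝ} {p : ℝ≥0∞} (hp : p ≠ 0) (hp' : p ≠ ∞) (k h : ℝ) (hf : Measurable f) :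
    ENNReal.ofReal (h - k) * μ {x | h < f x} ^ p.toReal⁻¹ ≤
      eLpNorm (fun x => max (f x - k) 0) p μ := by
  have hwm : Measurable fun x => max (f x - k) 0 := (hf.sub_const k).max measurable_const
  have hpp : 0 < p.toReal := ENNReal.toReal_pos hp hp'
  have h1 := mul_meas_ge_le_pow_eLpNorm' μ hp hp' hwm.aestronglyMeasurable (ENNReal.ofReal (h - k))
  have h2 := ENNReal.rpow_le_rpow h1 (inv_nonneg.2 hpp.le)
  rw [ENNReal.mul_rpow_of_nonneg _ _ (inv_nonneg.2 hpp.le), ENNReal.rpow_rpow_inv hpp.ne',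
    ENNReal.rpow_rpow_inv hpp.ne'] at h2
  refine le_trans ?_ h2
  gcongr with x
  intro hx
  refine le_trans (ENNReal.ofReal_le_ofReal ?_) (Real.ofReal_le_enorm _)
  exact (sub_le_sub_right hx.le k).trans (le_max_left _ _)

/-! ### Superlinear recursion and absorption -/

/-- A sequence with `yₙ₊₁ ≤ C 2ⁿ yₙ^(1+α)` tends to zero if its first term is small. -/
theorem le_mul_pow_of_superlinear_recursion {C α ε : ℝ} {y : ℕ → ℝ} (hC : 0 ≤ C) (hα : 0 < α)
    (hε : 0 < ε) (hsmall : C * ε ^ α ≤ 2 ^ (-α⁻¹)) (hy : ∀ n, 0 ≤ y n) (h0 : y 0 ≤ ε)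
    (hrec : ∀ n, y n ≤ ε → y (n + 1) ≤ C * 2 ^ n * y n ^ (1 + α)) (n : ℕ) :
    y n ≤ ε * ((2 : ℝ) ^ (-α⁻¹)) ^ n := by
  -- The ratio with `2 r^α = 1`: in the induction step `(r^n)^α` cancels the growth `2^n`, and `C
  -- ε^α ≤ r` supplies the next factor `r`.
  set r : ℝ := 2 ^ (-α⁻¹) with hr
  have hr0 : 0 < r := Real.rpow_pos_of_pos two_pos _
  have hr1 : r ≤ 1 := Real.rpow_le_one_of_one_le_of_nonpos one_le_two (by simp [hα.le])
  have hrα : 2 * r ^ α = 1 := by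
    rw [hr, ← Real.rpow_mul two_pos.le, neg_mul, inv_mul_cancel₀ hα.ne', Real.rpow_neg_one]
    norm_num
  induction n with
  | zero => simpa using h0
  | succ n ih =>
    have hle : y n ≤ ε := ih.trans (mul_le_of_le_one_right hε.le (pow_le_one₀ hr0.le hr1))
    have hpow : (r ^ n) ^ α = (r ^ α) ^ n := by
      rw [← Real.rpow_natCast_mul hr0.le, mul_comm, Real.rpow_mul_natCast hr0.le]
    calc y (n + 1) ≤ C * 2 ^ n * y n ^ (1 + α) := hrec n hle
      _ ≤ C * 2 ^ n * (ε * r ^ n) ^ (1 + α) := by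
          have := hy n
          gcongr
      _ = ε * r ^ n * (C * ε ^ α) * (2 * r ^ α) ^ n := by
          rw [Real.rpow_add (by positivity), Real.rpow_one,
            Real.mul_rpow hε.le (by positivity), hpow, mul_pow]
          ring
      _ ≤ ε * r ^ n * r * 1 := by
          rw [hrα, one_pow]
          gcongr
      _ = ε * r ^ (n + 1) := by ring

/-- By the two smallness conditions the terms in `X²` on the right add up to at most `X² / 2`.
Moving them to the left and dividing by `X` leaves the linear bound. -/
theorem le_of_sq_le_energy {A B K X k y a b : ℝ} (hA : 0 ≤ A) (hK : 0 ≤ K) (hk : 0 ≤ k)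
    (hX : 0 ≤ X) (hy : 0 ≤ y) (ha : 0 ≤ a)
    (h : X ^ 2 ≤ A * (K * ((X + k * y) * X) * a) + B * (X * b) ^ 2)
    (h1 : A * K * a ≤ 1 / 4) (h2 : B * b ^ 2 ≤ 1 / 4) :
    X ≤ 2 * A * K * k * (y * a) := by
  rcases hX.eq_or_lt with rfl | hX0
  · positivity
  have e1 := mul_le_mul_of_nonneg_right h1 (sq_nonneg X)
  have e2 := mul_le_mul_of_nonneg_right h2 (sq_nonneg X)
  refine le_of_mul_le_mul_right ?_ hX0
  nlinarith

/-! ### Energy estimate and decay of superlevel sets -/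

/-- The energy estimate on superlevel sets. -/
theorem DirichletForm.eLpNorm_posPart_sub_energy {M : Type u} [MeasurableSpace M] {μ : Measure M}
    [IsFiniteMeasure μ] (E : DirichletForm μ) {A B : ℝ} (hA : 0 ≤ A) (hB : 0 ≤ B)
    {p q : ℝ≥0∞} (hp : 2 < p) (hp' : p ≠ ∞) (hpq : q⁻¹ + (p⁻¹ + p⁻¹) < 1)
    (hS : ∀ v : E.domain, eLpNorm (v : Lp ℝ 2 μ) p μ ^ 2 ≤
      ENNReal.ofReal (A * E.form v v + B * ‖(v : Lp ℝ 2 μ)‖ ^ 2))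
    {W : M → ℝ} {K : ℝ≥0} (hWm : AEStronglyMeasurable W μ) (hW : eLpNorm W q μ ≤ K)
    (v : E.domain) (hv : 0 ≤ (v : Lp ℝ 2 μ)) (hsub : E.IsSubsolution W v) {k : ℝ} (hk : 0 < k) :
    ∃ X : ℝ, 0 ≤ X ∧
      eLpNorm (fun x => max ((v : Lp ℝ 2 μ) x - k) 0) p μ = ENNReal.ofReal X ∧
      X ^ 2 ≤ A * (K * ((X + k * μ.real {x | k < (v : Lp ℝ 2 μ) x} ^ p.toReal⁻¹) * X) *
        μ.real {x | k < (v : Lp ℝ 2 μ) x} ^ (1 - (q⁻¹ + (p⁻¹ + p⁻¹)).toReal)) +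
        B * (X * μ.real {x | k < (v : Lp ℝ 2 μ) x} ^ (1 / 2 - p.toReal⁻¹)) ^ 2 := by
  have hvm : Measurable (v : Lp ℝ 2 μ) := (Lp.stronglyMeasurable _).measurable
  obtain ⟨z, hzx, hz0, hzE⟩ := E.exists_posPart_sub_const hk v hv
  have hSz := hS z
  have hp2 : (2 : ℝ) < p.toReal := by
    simpa using (ENNReal.toReal_lt_toReal ENNReal.ofNat_ne_top hp').2 hp
  have hδ : 0 ≤ 1 - (q⁻¹ + (p⁻¹ + p⁻¹)).toReal :=
    sub_nonneg.2 (by simpa using ENNReal.toReal_mono ENNReal.one_ne_top hpq.le)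
  have hβ : 0 ≤ 1 / 2 - p.toReal⁻¹ := by
    rw [one_div, sub_nonneg]
    exact inv_anti₀ two_pos hp2.le
  have hI := (hsub z hz0).trans (le_of_eq (lintegral_congr_ae (g := fun x =>
    ENNReal.ofReal (W x * (v : Lp ℝ 2 μ) x * max ((v : Lp ℝ 2 μ) x - k) 0))
    (by filter_upwards [hzx] with x hx; rw [hx])))
  have hI2 := hI.trans (lintegral_mul_posPart_sub_le hk.le hWm hvm
    (one_le_two.trans hp.le) hp' hpq.le)
  have h2 := eLpNorm_two_posPart_sub_le k hvm hp.le (μ := μ)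
  rw [eLpNorm_congr_ae hzx] at hSz
  have hnorm : ENNReal.ofReal ‖(z : Lp ℝ 2 μ)‖ =
      eLpNorm (fun x => max ((v : Lp ℝ 2 μ) x - k) 0) 2 μ := by
    rw [Lp.norm_def, ENNReal.ofReal_toReal (Lp.eLpNorm_ne_top _), eLpNorm_congr_ae hzx]
  rw [← hnorm] at h2
  set m := μ.real {x | k < (v : Lp ℝ 2 μ) x} with hm
  have hm0 : 0 ≤ m := measureReal_nonneg
  have hμm : μ {x | k < (v : Lp ℝ 2 μ) x} = ENNReal.ofReal m := by
    rw [hm, ofReal_measureReal]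
  -- The right side of the Sobolev inequality is finite, so the `L^p` norm is a genuine real number
  -- `X`.
  have hXtop : eLpNorm (fun x => max ((v : Lp ℝ 2 μ) x - k) 0) p μ ≠ ∞ := by
    intro htop
    rw [htop] at hSz
    simp at hSz
  obtain ⟨X, hX0, hX⟩ : ∃ X : ℝ, 0 ≤ X ∧
      eLpNorm (fun x => max ((v : Lp ℝ 2 μ) x - k) 0) p μ = ENNReal.ofReal X :=
    ⟨_, ENNReal.toReal_nonneg, (ENNReal.ofReal_toReal hXtop).symm⟩
  refine ⟨X, hX0, hX, ?_⟩
  rw [hX, hμm, ENNReal.ofReal_rpow_of_nonneg hm0 hβ, ← ENNReal.ofReal_mul hX0,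
    ENNReal.ofReal_le_ofReal_iff (by positivity)] at h2
  have hI3 : ENNReal.ofReal (E.form v z) ≤ ENNReal.ofReal
      (K * ((X + k * m ^ p.toReal⁻¹) * X) * m ^ (1 - (q⁻¹ + (p⁻¹ + p⁻¹)).toReal)) := by
    refine hI2.trans ?_
    rw [hX, hμm, ENNReal.ofReal_rpow_of_nonneg hm0 (by positivity),
      ENNReal.ofReal_rpow_of_nonneg hm0 hδ, ← ENNReal.ofReal_mul hk.le,
      ← ENNReal.ofReal_add hX0 (by positivity),
      mul_assoc (K : ℝ), ENNReal.ofReal_mul K.coe_nonneg, ENNReal.ofReal_coe_nnreal,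
      ENNReal.ofReal_mul (by positivity), ENNReal.ofReal_mul (by positivity), mul_assoc]
    gcongr
  rw [ENNReal.ofReal_le_ofReal_iff (by positivity)] at hI3
  rw [hX, ← ENNReal.ofReal_pow hX0, ENNReal.ofReal_le_ofReal_iff
    (add_nonneg (mul_nonneg hA (E.nonneg z)) (by positivity))] at hSz
  refine hSz.trans ?_
  have := hzE.trans hI3
  gcongr

/-- The decay of the measure of superlevel sets, for small measure. -/
theorem DirichletForm.mul_rpow_measure_superlevel_le {M : Type u} [MeasurableSpace M]
    {μ : Measure M}
    [IsFiniteMeasure μ] (E : DirichletForm μ) {A B : ℝ} (hA : 0 ≤ A) (hB : 0 ≤ B)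
    {p q : ℝ≥0∞} (hp : 2 < p) (hp' : p ≠ ∞) (hpq : q⁻¹ + (p⁻¹ + p⁻¹) < 1)
    (hS : ∀ v : E.domain, eLpNorm (v : Lp ℝ 2 μ) p μ ^ 2 ≤
      ENNReal.ofReal (A * E.form v v + B * ‖(v : Lp ℝ 2 μ)‖ ^ 2))
    {W : M → ℝ} {K : ℝ≥0} (hWm : AEStronglyMeasurable W μ) (hW : eLpNorm W q μ ≤ K)
    (v : E.domain) (hv : 0 ≤ (v : Lp ℝ 2 μ)) (hsub : E.IsSubsolution W v)
    {α γ ε : ℝ} (hα : α = p.toReal * (1 - (q⁻¹ + (p⁻¹ + p⁻¹)).toReal))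
    (hγ : γ = p.toReal * (1 / 2 - p.toReal⁻¹)) (hα0 : 0 < α) (hγ0 : 0 < γ)
    (h1 : A * K * ε ^ α ≤ 1 / 4) (h2 : B * (ε ^ γ) ^ 2 ≤ 1 / 4) {k h : ℝ} (hk : 0 < k)
    (hkh : k ≤ h) (hy : μ.real {x | k < (v : Lp ℝ 2 μ) x} ^ p.toReal⁻¹ ≤ ε) :
    (h - k) * μ.real {x | h < (v : Lp ℝ 2 μ) x} ^ p.toReal⁻¹ ≤
      2 * A * K * k * (μ.real {x | k < (v : Lp ℝ 2 μ) x} ^ p.toReal⁻¹) ^ (1 + α) := by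
  have hvm : Measurable (v : Lp ℝ 2 μ) := (Lp.stronglyMeasurable _).measurable
  have hpp : 0 < p.toReal := ENNReal.toReal_pos (pos_of_gt hp).ne' hp'
  obtain ⟨X, hX0, hX, hXle⟩ :=
    E.eLpNorm_posPart_sub_energy hA hB hp hp' hpq hS hWm hW v hv hsub hk
  have hcheb := mul_rpow_measure_lt_le_eLpNorm (μ := μ) (pos_of_gt hp).ne' hp' k h hvm
  rw [hX, ← ofReal_measureReal, ENNReal.ofReal_rpow_of_nonneg measureReal_nonneg (by positivity),
    ← ENNReal.ofReal_mul (sub_nonneg.2 hkh), ENNReal.ofReal_le_ofReal_iff hX0] at hcheb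
  refine hcheb.trans ?_
  -- All powers of the measure become powers of `y = μ {v > k}^(1/p)`; this is where `α` and `γ`
  -- come from.
  have hpow (s : ℝ) : μ.real {x | k < (v : Lp ℝ 2 μ) x} ^ s =
      (μ.real {x | k < (v : Lp ℝ 2 μ) x} ^ p.toReal⁻¹) ^ (p.toReal * s) := by
    rw [← Real.rpow_mul measureReal_nonneg, inv_mul_cancel_left₀ hpp.ne']
  rw [hpow (1 - _), hpow (1 / 2 - _), ← hα, ← hγ] at hXle
  have hy0 : 0 ≤ μ.real {x | k < (v : Lp ℝ 2 μ) x} ^ p.toReal⁻¹ := by positivity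
  generalize μ.real {x | k < (v : Lp ℝ 2 μ) x} ^ p.toReal⁻¹ = y at *
  rw [Real.rpow_add' hy0 (by positivity), Real.rpow_one]
  refine le_of_sq_le_energy hA K.coe_nonneg hk.le hX0 hy0 (by positivity) hXle ?_ ?_
  · exact le_trans (by gcongr) h1
  · exact le_trans (by gcongr) h2

/-! ### Choice of constants and boundedness -/

/-- One threshold `ε` serves three purposes: the first two bounds permit absorption, the third makes
the recursion contract. -/
theorem exists_pos_forall_mul_rpow_le {α γ a b c d : ℝ} (hα : 0 < α) (hγ : 0 < γ) (hd : 0 < d) :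
    ∃ ε : ℝ, 0 < ε ∧ a * ε ^ α ≤ 1 / 4 ∧ b * (ε ^ γ) ^ 2 ≤ 1 / 4 ∧ c * ε ^ α ≤ d := by
  have hlim {s : ℝ} (hs : 0 < s) : Tendsto (fun ε : ℝ => ε ^ s) (𝓝[>] 0) (𝓝 0) := by
    have := (Real.continuousAt_rpow_const 0 s (Or.inr hs.le)).tendsto
    rw [Real.zero_rpow hs.ne'] at this
    exact this.mono_left nhdsWithin_le_nhds
  have e1 : Tendsto (fun ε : ℝ => a * ε ^ α) (𝓝[>] 0) (𝓝 0) := by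
    simpa using (hlim hα).const_mul a
  have e2 : Tendsto (fun ε : ℝ => b * (ε ^ γ) ^ 2) (𝓝[>] 0) (𝓝 0) := by
    simpa using ((hlim hγ).pow 2).const_mul b
  have e3 : Tendsto (fun ε : ℝ => c * ε ^ α) (𝓝[>] 0) (𝓝 0) := by
    simpa using (hlim hα).const_mul c
  obtain ⟨ε, h, h1, h2, h3⟩ := ((eventually_mem_nhdsWithin (a := (0 : ℝ)) (s := Set.Ioi 0)).and
    ((e1.eventually_le_const (by norm_num : (0 : ℝ) < 1 / 4)).and
      ((e2.eventually_le_const (by norm_num : (0 : ℝ) < 1 / 4)).and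
        (e3.eventually_le_const hd)))).exists
  exact ⟨ε, h, h1, h2, h3⟩

/-- Boundedness of subsolutions from a Sobolev inequality with exponent `p > 2`. -/
theorem DirichletForm.exists_ae_le_of_isSubsolution {A B : ℝ} (hA : 0 ≤ A) (hB : 0 ≤ B)
    {p q : ℝ≥0∞} (hp : 2 < p) (hp' : p ≠ ∞) (hpq : q⁻¹ + (p⁻¹ + p⁻¹) < 1) (K : ℝ≥0) :
    ∃ C : ℝ≥0, ∀ (M : Type u) [MeasurableSpace M] (μ : Measure M) [IsFiniteMeasure μ]
      (E : DirichletForm μ), (∀ v : E.domain, eLpNorm (v : Lp ℝ 2 μ) p μ ^ 2 ≤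
        ENNReal.ofReal (A * E.form v v + B * ‖(v : Lp ℝ 2 μ)‖ ^ 2)) →
      ∀ W : M → ℝ, AEStronglyMeasurable W μ → eLpNorm W q μ ≤ K →
      ∀ v : E.domain, 0 ≤ (v : Lp ℝ 2 μ) → E.IsSubsolution W v →
        ∀ᵐ x ∂μ, (v : Lp ℝ 2 μ) x ≤ C * ‖(v : Lp ℝ 2 μ)‖ := by
  have hp2 : (2 : ℝ) < p.toReal := by
    simpa using (ENNReal.toReal_lt_toReal ENNReal.ofNat_ne_top hp').2 hp
  have hpp : 0 < p.toReal := two_pos.trans hp2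
  obtain ⟨α, hα⟩ : ∃ α, α = p.toReal * (1 - (q⁻¹ + (p⁻¹ + p⁻¹)).toReal) := ⟨_, rfl⟩
  obtain ⟨γ, hγ⟩ : ∃ γ, γ = p.toReal * (1 / 2 - p.toReal⁻¹) := ⟨_, rfl⟩
  have hα0 : 0 < α := by
    rw [hα]
    refine mul_pos hpp (sub_pos.2 ?_)
    simpa using (ENNReal.toReal_lt_toReal hpq.ne_top ENNReal.one_ne_top).2 hpq
  have hγ0 : 0 < γ := by
    rw [hγ, one_div]
    exact mul_pos hpp (sub_pos.2 (inv_strictAnti₀ two_pos hp2))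
  obtain ⟨ε, hε, h1, h2, h3⟩ := exists_pos_forall_mul_rpow_le (a := A * K) (b := B)
    (c := 8 * A * K) hα0 hγ0 (Real.rpow_pos_of_pos two_pos (-α⁻¹))
  -- The final bound is `2k` with `k = ε^(-p/2) ‖v‖`, the level at which Chebyshev in `L²` gives `μ
  -- {v > k}^(1/p) ≤ ε`. Fixing `ε` before the measure space makes the constant uniform.
  refine ⟨(2 * ε ^ (-(p.toReal / 2))).toNNReal, ?_⟩
  intro M _ μ _ E hS W hWm hW v hv hsub
  rw [Real.coe_toNNReal _ (by positivity)]
  have hvm : Measurable (v : Lp ℝ 2 μ) := (Lp.stronglyMeasurable _).measurable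
  -- If `‖v‖ = 0` then `k = 0`, but truncation requires positive levels.
  rcases (norm_nonneg (v : Lp ℝ 2 μ)).eq_or_lt with hN | hN
  · have hv0 : (v : Lp ℝ 2 μ) = 0 := norm_eq_zero.1 hN.symm
    rw [← hN, hv0]
    filter_upwards [Lp.coeFn_zero ℝ 2 μ] with x hx
    rw [hx, mul_zero]; rfl
  obtain ⟨k, hk⟩ : ∃ k, k = ε ^ (-(p.toReal / 2)) * ‖(v : Lp ℝ 2 μ)‖ := ⟨_, rfl⟩
  have hk0 : 0 < k := by rw [hk]; positivity
  rw [mul_assoc, ← hk]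
  -- Levels rising from `k` towards `2k`, with gaps `k / 2^(n+1)`.
  obtain ⟨l, hl⟩ : ∃ l : ℕ → ℝ, ∀ n, l n = k * (2 - (1 / 2) ^ n) := ⟨_, fun _ => rfl⟩
  have hl0 (n : ℕ) : 0 < l n := by
    rw [hl]
    have : (1 / 2 : ℝ) ^ n ≤ 1 := pow_le_one₀ (by norm_num) (by norm_num)
    exact mul_pos hk0 (by linarith)
  have hl2 (n : ℕ) : l n ≤ 2 * k := by
    rw [hl, mul_comm 2 k]
    have : (0 : ℝ) < (1 / 2 : ℝ) ^ n := by positivity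
    exact mul_le_mul_of_nonneg_left (by linarith) hk0.le
  have hlsub (n : ℕ) : l (n + 1) - l n = k * (1 / 2) ^ (n + 1) := by
    rw [hl, hl]; ring
  have hinit : μ.real {x | l 0 < (v : Lp ℝ 2 μ) x} ^ p.toReal⁻¹ ≤ ε := by
    have hc := (mul_rpow_measure_lt_le_eLpNorm (μ := μ) two_ne_zero ENNReal.ofNat_ne_top
      0 (l 0) hvm).trans (eLpNorm_mono (g := (v : Lp ℝ 2 μ)) fun x => by
        rw [sub_zero, Real.norm_of_nonneg (le_max_right _ _)]
        exact max_le (Real.le_norm_self _) (norm_nonneg _))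
    rw [← ENNReal.ofReal_toReal (Lp.eLpNorm_ne_top _), ← Lp.norm_def, ← ofReal_measureReal,
      ENNReal.ofReal_rpow_of_nonneg measureReal_nonneg (by positivity), sub_zero,
      ← ENNReal.ofReal_mul (hl0 0).le, ENNReal.ofReal_le_ofReal_iff hN.le,
      ENNReal.toReal_ofNat] at hc
    have hlk : l 0 = k := by rw [hl]; norm_num
    rw [hlk] at hc ⊢
    have hc2 : μ.real {x | k < (v : Lp ℝ 2 μ) x} ^ (2⁻¹ : ℝ) ≤ ε ^ (p.toReal / 2) := by
      have : (ε ^ (p.toReal / 2))⁻¹ * μ.real {x | k < (v : Lp ℝ 2 μ) x} ^ (2⁻¹ : ℝ) ≤ 1 :=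
        le_of_mul_le_mul_right (by rwa [one_mul, mul_right_comm, ← Real.rpow_neg hε.le, ← hk]) hN
      rwa [inv_mul_le_iff₀ (by positivity), mul_one] at this
    have hc3 := Real.rpow_le_rpow (by positivity) hc2 (by positivity : 0 ≤ 2 * p.toReal⁻¹)
    rw [← Real.rpow_mul measureReal_nonneg, ← Real.rpow_mul hε.le] at hc3
    have e1 : (2⁻¹ : ℝ) * (2 * p.toReal⁻¹) = p.toReal⁻¹ := by ring
    have e2 : p.toReal / 2 * (2 * p.toReal⁻¹) = 1 := by field_simp
    rwa [e1, e2, Real.rpow_one] at hc3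
  have hdecay := le_mul_pow_of_superlinear_recursion (C := 8 * A * K)
    (y := fun n => μ.real {x | l n < (v : Lp ℝ 2 μ) x} ^ p.toReal⁻¹)
    (mul_nonneg (by positivity) K.coe_nonneg) hα0 hε h3 (fun n => by positivity) hinit
    (fun n hn => by
      have hstep := E.mul_rpow_measure_superlevel_le hA hB hp hp' hpq hS hWm hW v hv hsub hα hγ
        hα0 hγ0 h1 h2 (hl0 n) (sub_nonneg.1 (by rw [hlsub]; positivity) : l n ≤ l (n + 1)) hn
      rw [hlsub] at hstep
      -- Since `l n ≤ 2k`, the factor is at most `4 A K k`; dividing by the gap `k / 2^(n+1)` gives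
      -- `8 A K 2^n`.
      refine le_of_mul_le_mul_left (hstep.trans ?_) (by positivity : 0 < k * (1 / 2) ^ (n + 1))
      have hpow : (1 / 2 : ℝ) ^ n * 2 ^ n = 1 := by rw [← mul_pow]; norm_num
      calc _ ≤ 2 * A * K * (2 * k) *
            (μ.real {x | l n < (v : Lp ℝ 2 μ) x} ^ p.toReal⁻¹) ^ (1 + α) := by
            have := hl2 n
            gcongr
        _ = 4 * A * K * k * ((1 / 2) ^ n * 2 ^ n) *
            (μ.real {x | l n < (v : Lp ℝ 2 μ) x} ^ p.toReal⁻¹) ^ (1 + α) := by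
            rw [hpow]; ring
        _ = _ := by ring)
  have hr : Tendsto (fun n => ε * ((2 : ℝ) ^ (-α⁻¹)) ^ n) atTop (𝓝 (ε * 0)) :=
    (tendsto_pow_atTop_nhds_zero_of_lt_one (by positivity)
      (Real.rpow_lt_one_of_one_lt_of_neg one_lt_two (by simpa using hα0))).const_mul ε
  -- The set `{v > 2k}` lies in every `{v > l n}`, so its measure is dominated by a sequence tending
  -- to zero.
  have hlim : μ.real {x | 2 * k < (v : Lp ℝ 2 μ) x} ^ p.toReal⁻¹ ≤ ε * 0 := by
    refine ge_of_tendsto hr (Eventually.of_forall fun n => le_trans ?_ (hdecay n))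
    refine Real.rpow_le_rpow measureReal_nonneg (measureReal_mono fun x hx => ?_) (by positivity)
    exact (hl2 n).trans_lt hx
  have hzero : μ.real {x | 2 * k < (v : Lp ℝ 2 μ) x} = 0 := by
    by_contra hne
    have : 0 < μ.real {x | 2 * k < (v : Lp ℝ 2 μ) x} := lt_of_le_of_ne measureReal_nonneg (Ne.symm hne)
    have := Real.rpow_pos_of_pos this p.toReal⁻¹
    linarith
  rw [measureReal_eq_zero_iff] at hzero
  rw [ae_iff]
  simpa only [not_le] using hzero

theorem mainTheorem5 (ν A B : ℝ) (hν : 2 < ν) (hA : 0 < A) (hB : 0 < B)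
    (q : ℝ≥0∞) (hq : ENNReal.ofReal (ν / 2) < q) (K : ℝ≥0) :
    ∃ C : ℝ≥0, ∀ (M : Type u) [MeasurableSpace M] (μ : Measure M) [IsFiniteMeasure μ]
      (E : DirichletForm μ), E.SobolevInequality ν A B →
      ∀ W : M → ℝ, 0 ≤ᵐ[μ] W → MemLp W q μ → eLpNorm W q μ ≤ K →
      ∀ u : E.domain, 0 ≤ (u : Lp ℝ 2 μ) → E.IsSubsolution W u →
        MemLp (u : Lp ℝ 2 μ) ∞ μ ∧
          eLpNorm (u : Lp ℝ 2 μ) ∞ μ ≤ C * eLpNorm (u : Lp ℝ 2 μ) 2 μ := by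
  have hν2 : 0 < ν - 2 := sub_pos.2 hν
  have hp0 : 0 < 2 * ν / (ν - 2) := by positivity
  have hp : 2 < ENNReal.ofReal (2 * ν / (ν - 2)) := by
    rw [← ENNReal.ofReal_ofNat, ENNReal.ofReal_lt_ofReal_iff hp0, lt_div_iff₀ hν2]
    linarith
  -- For `p = 2ν/(ν-2)` one has `2/p = 1 - 2/ν`, so the condition is exactly `1/q < 2/ν`, that is `q
  -- > ν/2`.
  have hpq : q⁻¹ + ((ENNReal.ofReal (2 * ν / (ν - 2)))⁻¹ +
      (ENNReal.ofReal (2 * ν / (ν - 2)))⁻¹) < 1 := by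
    have hq' := ENNReal.inv_lt_inv.2 hq
    rw [← ENNReal.ofReal_inv_of_pos (by positivity)] at hq'
    rw [← ENNReal.ofReal_inv_of_pos hp0, ← ENNReal.ofReal_add (by positivity) (by positivity)]
    refine (ENNReal.add_lt_add_right ENNReal.ofReal_ne_top hq').trans_eq ?_
    rw [← ENNReal.ofReal_add (by positivity) (by positivity), ← ENNReal.ofReal_one]
    congr 1
    field_simp
    ring
  obtain ⟨C, hC⟩ := DirichletForm.exists_ae_le_of_isSubsolution.{u} hA.le hB.le hp
    ENNReal.ofReal_ne_top hpq K
  refine ⟨C, fun M _ μ _ E hS W _ hWm hW u hu hsub => ?_⟩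
  have hbound : ∀ᵐ x ∂μ, ‖(u : Lp ℝ 2 μ) x‖ ≤ C * ‖(u : Lp ℝ 2 μ)‖ := by
    filter_upwards [hC M μ E hS W hWm.1 hW u hu hsub, (Lp.coeFn_nonneg _).2 hu] with x hx h0
    rwa [Real.norm_of_nonneg h0]
  refine ⟨memLp_top_of_bound (Lp.aestronglyMeasurable _) _ hbound, ?_⟩
  rw [eLpNorm_exponent_top]
  refine (eLpNormEssSup_le_of_ae_bound hbound).trans_eq ?_
  rw [ENNReal.ofReal_mul C.coe_nonneg, Lp.norm_def, ENNReal.ofReal_toReal (Lp.eLpNorm_ne_top _),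
    ENNReal.ofReal_coe_nnreal]
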